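/- Let $H=\mathbb C^4$, let $$E_1=\mathrm{Diag}\Big(1,0,\tfrac1{\sqrt2},\tfrac1{\sqrt2}\Big),\qquad E_2=\mathrm{Diag}\Big(0,1,\tfrac1{\sqrt2},-\tfrac{i}{\sqrt2}\Big),$$ and let $\Phi(X)=E_1XE_1^\dagger+E_2XE_2^\dagger$ on $L(H)=M_4(\mathbb C)$, with Kraus operator space $K(\Phi)=\mathrm{span}_{\mathbb C}\{E_1,E_2\}$. For a super-operator $\Theta$ on $L(\mathbb C^m)$ put $\|\Theta\|_\diamond=\sup_{k\ge1}\sup_{\|X\|_1\le1}\|(\Theta\otimes \mathrm{id}_{M_k})(X)\|_1$ with $\|X\|_1=\mathrm{Tr}\,|X|$, $|X|=\sqrt{X^\dagger X}$, and $$D(\Theta,\mathrm{Conv}(\mathbf U(\mathbb C^m)))=\inf\{\|\Theta-\Psi\|_\diamond:\ \Psi \text{ a convex combination of unitary channels } X\mapsto UXU^\dagger,\ U\in \mathrm U(\mathbb C^m)\}.$$ Then: 1. $\Phi$ is a unital quantum channel (completely positive, trace-preserving, $\Phi(I)=I$) and a Schur channel: $\Phi(X)=S\circ X$ (entry-wise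 product) for some positive semidefinite $S$ with unit diagonal. 2. $K(\Phi)$ contains no unitary operator. 3. The minimum $C_\Phi=\min_{L\in K(\Phi)}\tfrac14\mathrm{Tr}\big((|L|-I_4)^2\big)$ is attained, is positive, and $$D\big(\Phi^{\otimes n},\mathrm{Conv}(\mathbf U(H^{\otimes n}))\big)\ \ge\ C_\Phi\qquad\text{for all } n\ge1.$$ In particular $D(\Phi^{\otimes n},\mathrm{Conv}(\mathbf U(H^{\otimes n})))$ does not tend to $0$ as $n\to\infty$, so $\Phi$ is a counterexample to the asymptotic quantum Birkhoff conjecture. 4. The four operators $E_1^\dagger E_1,\ E_1^\dagger E_2,\ E_2^\dagger E_1,\ E_2^\dagger E_2$ are linearly independent, and $\Phi$ is not factorizable. Here a linear map $T$ on $M_d(\mathbb C)$ is called factorizable if there are a von Neumann algebra $P$ with a faithful normal state $\chi$ and unital $*$-homomorphisms $J_0,J_1:M_d(\mathbb C)\to P$ such that, for $i=0,1$, $\chi(J_i(A))=\tfrac1d\mathrm{Tr}A$ and $\chi(J_i(A)x)=\chi(xJ_i(A))$ for all $A\in M_d(\mathbb C)$, $x\in P$ (that is, $J_i(M_d(\mathbb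 C))$ is fixed by the modular automorphism group of $\chi$), and $\tfrac1d\mathrm{Tr}(T(A)B)=\chi(J_1(A)J_0(B))$ for all $A,B\in M_d(\mathbb C)$. -/

import Mathlib

universe u

namespace QBirkhoff

open Matrix
open scoped ComplexOrder MatrixOrder ENNReal Topology Kronecker

noncomputable section

/-- A super-operator on `L(H)`, where `H = ℂ^ι` has the fixed orthonormal basis indexed by `ι`. -/
abbrev SuperOp (ι : Type*) : Type _ := Matrix ι ι ℂ →ₗ[ℂ] Matrix ι ι ℂ

/-! ### Tensor products of super-operators -/

/-- The block `X_{ab} ∈ L(H)` of `X = ∑ X_{ab} ⊗ |a⟩⟨b| ∈ L(H ⊗ ℂ^κ)`. -/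
def block {ι κ : Type*} (X : Matrix (ι × κ) (ι × κ) ℂ) (a b : κ) : Matrix ι ι ℂ :=
  Matrix.of fun i j => X (i, a) (j, b)

/-- The super-operator `Φ ⊗ id` on `L(H ⊗ ℂ^κ)`, which applies `Φ` to every block. -/
def ampliation {ι : Type*} (κ : Type*) (Φ : SuperOp ι) : SuperOp (ι × κ) where
  toFun X := Matrix.of fun p q => Φ (block X p.2 q.2) p.1 q.1
  map_add' X Y := by
    ext p q
    have h : block (X + Y) p.2 q.2 = block X p.2 q.2 + block Y p.2 q.2 := rfl
    simp only [Matrix.of_apply, h, map_add, Matrix.add_apply]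
  map_smul' c X := by
    ext p q
    have h : block (c • X) p.2 q.2 = c • block X p.2 q.2 := rfl
    simp only [Matrix.of_apply, h, map_smul, Matrix.smul_apply, RingHom.id_apply]

/-- `(Φ ⊗ id)(A ⊗ B) = Φ(A) ⊗ B`. -/
theorem ampliation_kronecker {ι κ : Type*} (Φ : SuperOp ι) (A : Matrix ι ι ℂ)
    (B : Matrix κ κ ℂ) : ampliation κ Φ (A ⊗ₖ B) = Φ A ⊗ₖ B := by
  ext p q
  have h : block (A ⊗ₖ B) p.2 q.2 = B p.2 q.2 • A := by
    ext i j; simp [block, mul_comm]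
  simp only [ampliation, LinearMap.coe_mk, AddHom.coe_mk, Matrix.of_apply, h, map_smul,
    Matrix.smul_apply, Matrix.kroneckerMap_apply, smul_eq_mul]
  ring

/-- The matrix of `A 0 ⊗ A 1 ⊗ ⋯ ⊗ A (n-1)` on `H^{⊗n}`, whose standard basis is indexed by the
words `Fin n → ι`. -/
def tensorMatrix {ι : Type*} {n : ℕ} (A : Fin n → Matrix ι ι ℂ) :
    Matrix (Fin n → ι) (Fin n → ι) ℂ :=
  Matrix.of fun i j => ∏ t, A t (i t) (j t)

/-- The tensor power `Φ^{⊗n}`, defined by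
`|k⟩⟨l| ↦ Φ(|k 0⟩⟨l 0|) ⊗ ⋯ ⊗ Φ(|k (n-1)⟩⟨l (n-1)|)` and linearity. -/
def tensorPower {ι : Type*} [Fintype ι] [DecidableEq ι] (Φ : SuperOp ι) (n : ℕ) :
    SuperOp (Fin n → ι) where
  toFun X := ∑ k, ∑ l, X k l • tensorMatrix fun t => Φ (Matrix.single (k t) (l t) 1)
  map_add' X Y := by simp only [Matrix.add_apply, add_smul, Finset.sum_add_distrib]
  map_smul' c X := by
    simp only [Matrix.smul_apply, smul_assoc, Finset.smul_sum, RingHom.id_apply]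

/-- `Φ^{⊗n}(A 0 ⊗ ⋯ ⊗ A (n-1)) = Φ(A 0) ⊗ ⋯ ⊗ Φ(A (n-1))`. -/
theorem tensorPower_tensorMatrix {ι : Type*} [Fintype ι] [DecidableEq ι] (Φ : SuperOp ι) (n : ℕ)
    (A : Fin n → Matrix ι ι ℂ) :
    tensorPower Φ n (tensorMatrix A) = tensorMatrix fun t => Φ (A t) := by
  have key : ∀ (B : Matrix ι ι ℂ) (p q : ι),
      Φ B p q = ∑ kl : ι × ι, B kl.1 kl.2 * Φ (Matrix.single kl.1 kl.2 1) p q := by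
    intro B p q
    conv_lhs => rw [Matrix.matrix_eq_sum_single B]
    rw [Fintype.sum_prod_type]
    simp only [map_sum, Matrix.sum_apply]
    refine Finset.sum_congr rfl fun k _ => Finset.sum_congr rfl fun l _ => ?_
    rw [show Matrix.single k l (B k l) = B k l • Matrix.single k l (1 : ℂ) by simp, map_smul]
    simp
  ext p q
  simp only [tensorMatrix, Matrix.of_apply]
  simp_rw [key (A _)]
  rw [Finset.prod_univ_sum, Fintype.piFinset_univ]
  simp only [tensorPower, tensorMatrix, LinearMap.coe_mk, AddHom.coe_mk, Matrix.sum_apply,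
    Matrix.smul_apply, Matrix.of_apply, smul_eq_mul, ← Finset.prod_mul_distrib]
  rw [← Fintype.sum_prod_type'
    (f := fun (k l : Fin n → ι) => ∏ t, A t (k t) (l t) * Φ (Matrix.single (k t) (l t) 1) (p t) (q t))]
  refine (Fintype.sum_equiv (Equiv.arrowProdEquivProdArrow (Fin n) (fun _ => ι) (fun _ => ι))
    _ _ ?_).symm
  intro x
  rfl

/-! ### Channels -/

/-- The super-operator `∑ₖ Eₖ · Eₖ†`. -/
def krausMap {ι κ : Type*} [Fintype ι] [Fintype κ] (E : κ → Matrix ι ι ℂ) : SuperOp ι where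
  toFun X := ∑ k, E k * X * (E k)ᴴ
  map_add' X Y := by simp only [mul_add, add_mul, Finset.sum_add_distrib]
  map_smul' c X := by
    simp only [Matrix.mul_smul, Matrix.smul_mul, Finset.smul_sum, RingHom.id_apply]

/-- The Kraus operator space of `∑ₖ Eₖ · Eₖ†`, the linear span of the Kraus operators. -/
def krausSpace {ι κ : Type*} (E : κ → Matrix ι ι ℂ) : Submodule ℂ (Matrix ι ι ℂ) :=
  Submodule.span ℂ (Set.range E)

/-- Trace-preserving, completely positive and unital super-operators. -/
structure IsUnitalQuantumChannel {ι : Type*} [Fintype ι] [DecidableEq ι] (Φ : SuperOp ι) :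
    Prop where
  trace_preserving : ∀ X, (Φ X).trace = X.trace
  completely_positive : ∀ n : ℕ, 1 ≤ n → ∀ X : Matrix (ι × Fin n) (ι × Fin n) ℂ,
    X.PosSemidef → (ampliation (Fin n) Φ X).PosSemidef
  unital : Φ 1 = 1

/-- Schur channels: entry-wise multiplication by a positive semidefinite matrix with unit
diagonal. -/
def IsSchurChannel {ι : Type*} (Φ : SuperOp ι) : Prop :=
  ∃ S : Matrix ι ι ℂ, S.PosSemidef ∧ (∀ k, S k k = 1) ∧ ∀ X, Φ X = S ⊙ X

/-- The unitary channels `X ↦ U X U†` on `L(H)`. -/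
def unitaryChannels (ι : Type*) [Fintype ι] [DecidableEq ι] : Set (SuperOp ι) :=
  {Φ | ∃ U ∈ Matrix.unitaryGroup ι ℂ, ∀ X, Φ X = U * X * Uᴴ}

/-! ### Diamond norm and distances -/

/-- `‖X‖₁ = Tr |X|`, with `|X| = √(X†X)`. -/
def traceNorm {ι : Type*} [Fintype ι] [DecidableEq ι] (X : Matrix ι ι ℂ) : ℝ :=
  (CFC.abs X).trace.re

/-- `‖Φ‖₁ = sup {‖Φ(X)‖₁ : ‖X‖₁ ≤ 1}`, as a supremum in `[0, ∞]`. -/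
def superTraceNorm {ι : Type*} [Fintype ι] [DecidableEq ι] (Φ : SuperOp ι) : ℝ≥0∞ :=
  ⨆ (X : Matrix ι ι ℂ) (_ : traceNorm X ≤ 1), ENNReal.ofReal (traceNorm (Φ X))

/-- `‖Φ‖_⋄ = sup {‖Φ ⊗ id_{L(ℂ^n)}‖₁ : n ≥ 1}`, as a supremum in `[0, ∞]`. -/
def diamondNorm {ι : Type*} [Fintype ι] [DecidableEq ι] (Φ : SuperOp ι) : ℝ≥0∞ :=
  ⨆ (n : ℕ) (_ : 1 ≤ n), superTraceNorm (ampliation (Fin n) Φ)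

/-- The distance `D(Φ, Conv(U(H)))` in diamond norm from `Φ` to the mixtures of unitary
channels. -/
def distToUnitaryMixtures {ι : Type*} [Fintype ι] [DecidableEq ι] (Φ : SuperOp ι) : ℝ≥0∞ :=
  ⨅ Ψ ∈ convexHull ℝ (unitaryChannels ι), diamondNorm (Φ - Ψ)

/-- The asymptotic quantum Birkhoff property:
`D(Φ^{⊗n}, Conv(U(H^{⊗n}))) → 0` as `n → ∞`. -/
def AsymptoticBirkhoff {ι : Type*} [Fintype ι] [DecidableEq ι] (Φ : SuperOp ι) : Prop :=
  Filter.Tendsto (fun n : ℕ => distToUnitaryMixtures (tensorPower Φ n)) Filter.atTop (𝓝 0)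

/-- The quantity `Tr (|L| - I_d)² / d`. -/
def unitaryDefect {ι : Type*} [Fintype ι] [DecidableEq ι] (L : Matrix ι ι ℂ) : ℝ :=
  ((CFC.abs L - 1) ^ 2).trace.re / Fintype.card ι

/-! ### Factorizable maps -/

/-- Faithful normal states on a von Neumann algebra. -/
structure IsFaithfulNormalState {P : Type u} [CStarAlgebra P] [PartialOrder P]
    [StarOrderedRing P] [WStarAlgebra P] (χ : P →ₗ[ℂ] ℂ) : Prop where
  map_one : χ 1 = 1
  nonneg : ∀ x, 0 ≤ χ (star x * x)
  faithful : ∀ x, χ (star x * x) = 0 → x = 0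
  normal : ∀ D : Set P, (∀ x ∈ D, IsSelfAdjoint x) → D.Nonempty → DirectedOn (· ≤ ·) D →
    ∀ a, IsLUB D a → IsLUB (χ '' D) (χ a)

/-- A unital `*`-homomorphism `J : L(H) → P` is Markov for the normalized trace of `L(H)` and the
state `χ` of `P`: it transports the trace to `χ`, and it intertwines the modular groups. The modular
group of the trace is trivial, so the latter says that the modular group of `χ` fixes the range of
`J`, that is, the range of `J` lies in the centralizer of `χ`. -/
def IsMarkovEmbedding {ι : Type*} [Fintype ι] [DecidableEq ι] {P : Type u} [CStarAlgebra P]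
    (χ : P →ₗ[ℂ] ℂ) (J : Matrix ι ι ℂ →⋆ₐ[ℂ] P) : Prop :=
  (∀ A, χ (J A) = A.trace / Fintype.card ι) ∧ ∀ A x, χ (J A * x) = χ (x * J A)

/-- Factorizable maps on `L(H)` with its normalized trace: `Φ = J₀* ∘ J₁` for Markov embeddings
`J₀`, `J₁` of `L(H)` into a von Neumann algebra `P` with a faithful normal state `χ`, where the
adjoint `J₀*` is determined by `Tr(J₀*(x) B) / d = χ(x J₀(B))`. -/
def IsFactorizable {ι : Type*} [Fintype ι] [DecidableEq ι] (Φ : SuperOp ι) : Prop :=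
  ∃ (P : Type u) (_ : CStarAlgebra P) (_ : PartialOrder P) (_ : StarOrderedRing P)
    (_ : WStarAlgebra P) (χ : P →ₗ[ℂ] ℂ) (J₀ J₁ : Matrix ι ι ℂ →⋆ₐ[ℂ] P),
    IsFaithfulNormalState χ ∧ IsMarkovEmbedding χ J₀ ∧ IsMarkovEmbedding χ J₁ ∧
      ∀ A B, (Φ A * B).trace / Fintype.card ι = χ (J₁ A * J₀ B)

/-! ### The example -/

/-- `E₁ = Diag(1, 0, 1/√2, 1/√2)` and `E₂ = Diag(0, 1, 1/√2, -i/√2)`. -/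
def exampleKraus : Fin 2 → Matrix (Fin 4) (Fin 4) ℂ :=
  ![Matrix.diagonal ![1, 0, 1 / (Real.sqrt 2 : ℂ), 1 / (Real.sqrt 2 : ℂ)],
    Matrix.diagonal ![0, 1, 1 / (Real.sqrt 2 : ℂ), -Complex.I / (Real.sqrt 2 : ℂ)]]

/-- The channel `E₁ · E₁† + E₂ · E₂†`. -/
def exampleChannel : SuperOp (Fin 4) := krausMap exampleKraus

end

end QBirkhoff

namespace QBirkhoff

open Matrix
open scoped ComplexOrder MatrixOrder ENNReal Topology Kronecker

noncomputable section

/-! ### Trace norm and diamond norm -/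

/-! Distance bound: one linear functional separates `Φ^{⊗n}` from all unitary channels, with a gap
independent of `n`. Let `q` be the projection of `ℂ^d` onto the diagonals of the operators in
`K(Φ)`. Apply the channel to the maximally entangled state, restrict to the span of the vectors `|k⟩
⊗ |k⟩`, and test there with `q` on the first tensor factor and `1` on the others. `Φ^{⊗n}` scores
`1`, because `q` fixes the diagonals of the Kraus operators. A unitary channel enters only through
the diagonal of `U`, which splits into vectors `v ∈ ℂ^d` with entries in the unit disc. As `qv` is
the diagonal of some `L ∈ K(Φ)`, the lower bound `C` on the defect of `L` forces `⟨v, qv⟩ ≤ d(1 -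
C)` (`re_star_dotProduct_diagProj_le`), so the score is at most `1 - C`
(`le_distToUnitaryMixtures_tensorPower`).

Factorizability: a factorization yields `1 = ∑ w_l J₀(E_l†)` with `w_l` intertwining `J₀` and `J₁`
(`sum_intertwiner_mul_eq_one`). The products `w_i* w_j` commute with the range of `J₀`, so each
basis vector gives a scalar-coefficient relation between them (`sum_smul_star_mul_eq_one`). In the
example these four relations say that `v = w_0` and `w = w_1` are isometries with `v* w = 0`. But
the faithful state `χ` is tracial on `v`, which makes `v` unitary; then `w = 0`, a contradiction. -/

theorem trace_mul_nonneg {ι : Type*} [Fintype ι] [DecidableEq ι] {A B : Matrix ι ι ℂ}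
    (hA : A.PosSemidef) (hB : B.PosSemidef) : 0 ≤ (A * B).trace := by
  obtain ⟨C, rfl⟩ := CStarAlgebra.nonneg_iff_eq_star_mul_self.mp hA.nonneg
  rw [Matrix.star_eq_conjTranspose, Matrix.mul_assoc, Matrix.trace_mul_comm]
  exact (hB.mul_mul_conjTranspose_same C).trace_nonneg

theorem trace_submatrix_le {ι κ : Type*} [Fintype ι] [Fintype κ] [DecidableEq κ]
    {A : Matrix κ κ ℂ} (hA : A.PosSemidef) {s : ι → κ} (hs : Function.Injective s) :
    (A.submatrix s s).trace ≤ A.trace := by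
  simp only [Matrix.trace, Matrix.diag_apply, Matrix.submatrix_apply]
  rw [← Finset.sum_image (f := fun k => A k k) (s := Finset.univ) (g := s) (fun a _ b _ h => hs h)]
  exact Finset.sum_le_sum_of_subset_of_nonneg (Finset.subset_univ _) fun k _ _ => hA.diag_nonneg

/-- Testing the trace norm of a Hermitian matrix against `0 ≤ Q ≤ 1` on a coordinate subspace. -/
theorem trace_mul_submatrix_le_traceNorm {ι κ : Type*} [Fintype ι] [DecidableEq ι] [Fintype κ]
    [DecidableEq κ] {X : Matrix κ κ ℂ} (hX : X.IsHermitian) {s : ι → κ}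
    (hs : Function.Injective s) {Q : Matrix ι ι ℂ} (hQ : Q.PosSemidef) (hQ1 : (1 - Q).PosSemidef) :
    (Q * X.submatrix s s).trace.re ≤ traceNorm X := by
  have habs : (CFC.abs X).PosSemidef := Matrix.nonneg_iff_posSemidef.mp (CFC.abs_nonneg X)
  have hle : (CFC.abs X - X).PosSemidef := by
    rw [CFC.abs_sub_self X hX]
    exact Matrix.nonneg_iff_posSemidef.mp (nsmul_nonneg (CFC.negPart_nonneg X) 2)
  -- With `Y'` the compression of `Y` along `s`, the chain is `Tr(Q X') ≤ Tr(Q |X|') ≤ Tr |X|' ≤ Tr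
  -- |X|`.
  have h1 := trace_mul_nonneg hQ (hle.submatrix s)
  have h2 := trace_mul_nonneg hQ1 (habs.submatrix s)
  have h3 := trace_submatrix_le habs hs
  rw [Matrix.submatrix_sub, Pi.sub_apply, Pi.sub_apply, Matrix.mul_sub, Matrix.trace_sub] at h1
  rw [Matrix.sub_mul, Matrix.one_mul, Matrix.trace_sub] at h2
  have h := add_nonneg (add_nonneg h1 h2) (sub_nonneg.mpr h3)
  have := (Complex.le_def.mp h).1
  simp only [Complex.zero_re, Complex.add_re, Complex.sub_re] at this
  rw [traceNorm]
  linarith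

/-- The maximally entangled state on `ℂ^ι ⊗ ℂ^κ` with respect to a bijection of the bases. -/
def maxEntangled {ι κ : Type*} [Fintype ι] [DecidableEq ι] (e : κ ≃ ι) :
    Matrix (ι × κ) (ι × κ) ℂ :=
  (Fintype.card ι : ℂ)⁻¹ • Matrix.vecMulVec (fun p => if p.1 = e p.2 then 1 else 0)
    (star fun p => if p.1 = e p.2 then 1 else 0)

theorem block_maxEntangled {ι κ : Type*} [Fintype ι] [DecidableEq ι] (e : κ ≃ ι) (a b : κ) :
    block (maxEntangled e) a b = (Fintype.card ι : ℂ)⁻¹ • Matrix.single (e a) (e b) 1 := by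
  ext i j
  simp only [block, maxEntangled, Matrix.of_apply, Matrix.smul_apply, Matrix.vecMulVec_apply,
    Pi.star_apply, Matrix.single_apply, eq_comm (a := i), eq_comm (a := j)]
  split_ifs <;> simp_all

theorem posSemidef_maxEntangled {ι κ : Type*} [Fintype ι] [DecidableEq ι] [Finite κ] (e : κ ≃ ι) :
    (maxEntangled e).PosSemidef :=
  (Matrix.posSemidef_vecMulVec_self_star _).smul (by positivity)

theorem traceNorm_maxEntangled {ι κ : Type*} [Fintype ι] [DecidableEq ι] [Nonempty ι] [Fintype κ]
    [DecidableEq κ] (e : κ ≃ ι) : traceNorm (maxEntangled e) = 1 := by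
  rw [traceNorm, CFC.abs_of_nonneg _ (posSemidef_maxEntangled e).nonneg, maxEntangled,
    Matrix.trace_smul, Matrix.trace, Fintype.sum_prod_type, Finset.sum_comm]
  have : (Fintype.card κ : ℂ) ≠ 0 := by
    rw [Fintype.card_congr e]
    exact Nat.cast_ne_zero.mpr Fintype.card_ne_zero
  simp [Matrix.vecMulVec_apply, ← Fintype.card_congr e, this]

/-- A lower bound for the diamond norm: test the image of the maximally entangled state. -/
theorem le_diamondNorm {ι : Type*} [Fintype ι] [DecidableEq ι] [Nonempty ι] {Θ : SuperOp ι}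
    (hΘ : ∀ X, Θ Xᴴ = (Θ X)ᴴ) {Q : Matrix ι ι ℂ} (hQ : Q.PosSemidef) (hQ1 : (1 - Q).PosSemidef) :
    ENNReal.ofReal ((∑ l, ∑ k, Q l k * Θ (Matrix.single k l 1) k l).re / Fintype.card ι)
      ≤ diamondNorm Θ := by
  set e : Fin (Fintype.card ι) ≃ ι := (Fintype.equivFin ι).symm
  have hent : ∀ p q, ampliation (Fin (Fintype.card ι)) Θ (maxEntangled e) p q
      = (Fintype.card ι : ℂ)⁻¹ * Θ (Matrix.single (e p.2) (e q.2) 1) p.1 q.1 := by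
    intro p q
    simp only [ampliation, LinearMap.coe_mk, AddHom.coe_mk, Matrix.of_apply, block_maxEntangled,
      map_smul, Matrix.smul_apply, smul_eq_mul]
  have hherm : (ampliation (Fin (Fintype.card ι)) Θ (maxEntangled e)).IsHermitian := by
    ext p q
    rw [Matrix.conjTranspose_apply, hent, hent, star_mul', ← Matrix.conjTranspose_apply, ← hΘ]
    simp
  -- The coordinates `(k, e.symm k)` carry the vectors `|k⟩ ⊗ |k⟩`; there the image has entries
  -- `Θ(|k⟩⟨l|)_{kl} / d`.
  have hs : Function.Injective fun k : ι => (k, e.symm k) := fun a b h => congrArg Prod.fst h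
  have h1 := trace_mul_submatrix_le_traceNorm hherm hs hQ hQ1
  have h2 : (Q * (ampliation (Fin (Fintype.card ι)) Θ (maxEntangled e)).submatrix
      (fun k : ι => (k, e.symm k)) (fun k : ι => (k, e.symm k))).trace
      = (∑ l, ∑ k, Q l k * Θ (Matrix.single k l 1) k l) * ((Fintype.card ι : ℝ)⁻¹ : ℝ) := by
    simp only [Matrix.trace, Matrix.diag_apply, Matrix.mul_apply, Matrix.submatrix_apply, hent,
      Equiv.apply_symm_apply, Finset.sum_mul]
    refine Finset.sum_congr rfl fun l _ => Finset.sum_congr rfl fun k _ => ?_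
    push_cast
    ring
  rw [h2, Complex.re_mul_ofReal, ← div_eq_mul_inv] at h1
  calc _ ≤ ENNReal.ofReal (traceNorm (ampliation (Fin (Fintype.card ι)) Θ (maxEntangled e))) :=
        ENNReal.ofReal_le_ofReal h1
    _ ≤ superTraceNorm (ampliation (Fin (Fintype.card ι)) Θ) :=
        le_iSup₂_of_le (maxEntangled e) (traceNorm_maxEntangled e).le le_rfl
    _ ≤ diamondNorm Θ := le_iSup₂_of_le (Fintype.card ι) Fintype.card_pos le_rfl

/-- Both conclusions define convex sets, so unitary channels suffice. Preservation of adjoints is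
kept because `le_diamondNorm` needs it for `Φ - Ψ`. -/
theorem convexHull_unitaryChannels_subset {ι : Type*} [Fintype ι] [DecidableEq ι]
    {f : SuperOp ι →ₗ[ℝ] ℝ} {c : ℝ}
    (hf : ∀ U ∈ Matrix.unitaryGroup ι ℂ, ∀ Ψ : SuperOp ι, (∀ X, Ψ X = U * X * Uᴴ) → f Ψ ≤ c)
    {Ψ : SuperOp ι} (hΨ : Ψ ∈ convexHull ℝ (unitaryChannels ι)) :
    (∀ X, Ψ Xᴴ = (Ψ X)ᴴ) ∧ f Ψ ≤ c := by
  have hsub : convexHull ℝ (unitaryChannels ι) ⊆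
      {Ψ : SuperOp ι | (∀ X, Ψ Xᴴ = (Ψ X)ᴴ) ∧ f Ψ ≤ c} := by
    refine convexHull_min ?_ (Convex.inter ?_ (convex_halfSpace_le f.isLinear c))
    · rintro Ψ ⟨U, hU, h⟩
      refine ⟨fun X => ?_, hf U hU Ψ h⟩
      simp [h, Matrix.mul_assoc]
    · intro Ψ₁ h₁ Ψ₂ h₂ a b _ _ _ X
      have h₁' := h₁ X
      have h₂' := h₂ X
      simp [h₁', h₂']
  exact hsub hΨ

/-- The functional `Ψ ↦ Re ∑ Q l k Ψ(|k⟩⟨l|)_{kl}`. -/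
def choiFunctional {ι : Type*} [Fintype ι] [DecidableEq ι] (Q : Matrix ι ι ℂ) :
    SuperOp ι →ₗ[ℝ] ℝ where
  toFun Ψ := (∑ l, ∑ k, Q l k * Ψ (Matrix.single k l 1) k l).re
  map_add' Ψ₁ Ψ₂ := by
    simp only [LinearMap.add_apply, Matrix.add_apply, mul_add, Finset.sum_add_distrib,
      Complex.add_re]
  map_smul' c Ψ := by
    simp only [LinearMap.smul_apply, Matrix.smul_apply, RingHom.id_apply, smul_eq_mul,
      Complex.real_smul, mul_left_comm _ (c : ℂ), ← Finset.mul_sum, Complex.re_ofReal_mul]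

/-- The easy half of norm duality: the gap between the value of the test at `Φ` and its maximum over
unitary channels bounds the distance to their convex hull. -/
theorem le_distToUnitaryMixtures {ι : Type*} [Fintype ι] [DecidableEq ι] [Nonempty ι]
    {Φ : SuperOp ι} (hΦ : ∀ X, Φ Xᴴ = (Φ X)ᴴ) {Q : Matrix ι ι ℂ} (hQ : Q.PosSemidef)
    (hQ1 : (1 - Q).PosSemidef) {c : ℝ}
    (hc : ∀ U ∈ Matrix.unitaryGroup ι ℂ, (∑ l, ∑ k, Q l k * (U k k * star (U l l))).re ≤ c) :
    ENNReal.ofReal ((choiFunctional Q Φ - c) / Fintype.card ι) ≤ distToUnitaryMixtures Φ := by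
  refine le_iInf₂ fun Ψ hΨ => ?_
  have key := convexHull_unitaryChannels_subset (f := choiFunctional Q) (c := c) ?_ hΨ
  · refine le_trans (ENNReal.ofReal_le_ofReal ?_)
      (le_diamondNorm (Θ := Φ - Ψ) (fun X => ?_) hQ hQ1)
    · change _ ≤ choiFunctional Q (Φ - Ψ) / _
      rw [map_sub]
      gcongr
      exact key.2
    · simp [hΦ, key.1]
  · intro U hU Ψ h
    refine le_trans (le_of_eq ?_) (hc U hU)
    simp only [choiFunctional, LinearMap.coe_mk, AddHom.coe_mk, h]
    congr 1
    refine Finset.sum_congr rfl fun l _ => Finset.sum_congr rfl fun k _ => ?_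
    congr 1
    simp [Matrix.mul_apply, Matrix.single_apply, ite_and, Finset.sum_ite_eq]

/-! ### Schur channels with diagonal Kraus operators -/

section Schur

variable {ι κ : Type*}

/-- Only the summand `|k⟩⟨l|` contributes to the entry `(k, l)`, since a Schur map fixes matrix
units up to scalars. -/
theorem tensorPower_apply_of_schur [Fintype ι] [DecidableEq ι] {Φ : SuperOp ι} {S : Matrix ι ι ℂ}
    (hΦ : ∀ X i j, Φ X i j = S i j * X i j) (n : ℕ) (X : Matrix (Fin n → ι) (Fin n → ι) ℂ)
    (k l : Fin n → ι) : tensorPower Φ n X k l = (∏ t, S (k t) (l t)) * X k l := by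
  have h : ∀ k' l' : Fin n → ι, (∏ t, Matrix.single (k' t) (l' t) (1 : ℂ) (k t) (l t))
      = if k' = k then if l' = l then 1 else 0 else 0 := by
    intro k' l'
    simp only [Matrix.single_apply, Finset.prod_ite_zero, Finset.prod_const_one, ← ite_and,
      Finset.mem_univ, true_imp_iff, funext_iff, forall_and]
  simp [tensorPower, Matrix.sum_apply, tensorMatrix, hΦ, Finset.prod_mul_distrib, h, mul_comm]

/-- The matrix whose columns are the diagonals of the Kraus operators `diagonal (d k)`. -/
def diagColumns (d : κ → ι → ℂ) : Matrix ι κ ℂ :=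
  Matrix.of fun i k => d k i

variable [Fintype ι] [DecidableEq ι] [Fintype κ] {d : κ → ι → ℂ}

theorem krausMap_diagonal_apply (d : κ → ι → ℂ) (X : Matrix ι ι ℂ) (i j : ι) :
    krausMap (fun k => Matrix.diagonal (d k)) X i j
      = (diagColumns d * (diagColumns d)ᴴ) i j * X i j := by
  rw [Matrix.mul_apply, Finset.sum_mul]
  simp only [krausMap, LinearMap.coe_mk, AddHom.coe_mk, Matrix.sum_apply, diagColumns,
    Matrix.diagonal_conjTranspose, Matrix.mul_diagonal, Matrix.diagonal_mul, Pi.star_apply,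
    Matrix.conjTranspose_apply, Matrix.of_apply]
  exact Finset.sum_congr rfl fun k _ => by ring

theorem isSchurChannel_krausMap_diagonal
    (hd : ∀ i, (diagColumns d * (diagColumns d)ᴴ) i i = 1) :
    IsSchurChannel (krausMap fun k => Matrix.diagonal (d k)) := by
  refine ⟨_, Matrix.posSemidef_self_mul_conjTranspose (diagColumns d), hd, fun X => ?_⟩
  ext i j
  rw [krausMap_diagonal_apply, Matrix.hadamard_apply]

theorem isUnitalQuantumChannel_krausMap_diagonal
    (hd : ∀ i, (diagColumns d * (diagColumns d)ᴴ) i i = 1) :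
    IsUnitalQuantumChannel (krausMap fun k => Matrix.diagonal (d k)) where
  trace_preserving X := by
    simp [Matrix.trace, krausMap_diagonal_apply, hd]
  completely_positive n _ X hX := by
    have : ampliation (Fin n) (krausMap fun k => Matrix.diagonal (d k)) X
        = ∑ k, Matrix.diagonal (fun p : ι × Fin n => d k p.1) * X
          * (Matrix.diagonal fun p : ι × Fin n => d k p.1)ᴴ := by
      ext p q
      simp only [ampliation, LinearMap.coe_mk, AddHom.coe_mk, Matrix.of_apply, block, krausMap,
        Matrix.sum_apply, Matrix.diagonal_conjTranspose, Matrix.mul_diagonal,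
        Matrix.diagonal_mul, Pi.star_apply]
    rw [this]
    exact Matrix.posSemidef_sum _ fun k _ => hX.mul_mul_conjTranspose_same _
  unital := by
    ext i j
    rw [krausMap_diagonal_apply]
    by_cases h : i = j
    · subst h; simp [hd]
    · simp [h]

omit [Fintype ι] in
theorem diagonal_mulVec_mem_krausSpace (d : κ → ι → ℂ) (c : κ → ℂ) :
    Matrix.diagonal (diagColumns d *ᵥ c) ∈ krausSpace fun k => Matrix.diagonal (d k) := by
  have : Matrix.diagonal (diagColumns d *ᵥ c) = ∑ k, c k • Matrix.diagonal (d k) := by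
    ext i j
    by_cases h : i = j
    · subst h
      simp [Matrix.sum_apply, Matrix.mulVec, dotProduct, diagColumns, mul_comm]
    · simp [Matrix.sum_apply, h]
  rw [this]
  exact Submodule.sum_smul_mem _ _ fun k _ => Submodule.subset_span ⟨k, rfl⟩

omit [Fintype ι] in
theorem mem_krausSpace_diagonal_iff (d : κ → ι → ℂ) (L : Matrix ι ι ℂ) :
    L ∈ krausSpace (fun k => Matrix.diagonal (d k)) ↔
      ∃ c : κ → ℂ, Matrix.diagonal (diagColumns d *ᵥ c) = L := by
  refine ⟨fun h => ?_, fun ⟨c, hc⟩ => hc ▸ diagonal_mulVec_mem_krausSpace d c⟩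
  obtain ⟨c, rfl⟩ := (Submodule.mem_span_range_iff_exists_fun ℂ).mp h
  refine ⟨c, ?_⟩
  ext i j
  by_cases h : i = j
  · subst h
    simp [Matrix.sum_apply, Matrix.mulVec, dotProduct, diagColumns, mul_comm]
  · simp [Matrix.sum_apply, h]

theorem abs_diagonal (f : ι → ℂ) :
    CFC.abs (Matrix.diagonal f) = Matrix.diagonal fun i => (‖f i‖ : ℂ) := by
  refine CFC.sqrt_unique ?_ ?_
  · rw [Matrix.star_eq_conjTranspose, Matrix.diagonal_conjTranspose, Matrix.diagonal_mul_diagonal,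
      Matrix.diagonal_mul_diagonal]
    congr 1
    funext i
    rw [Pi.star_apply, Complex.star_def, Complex.conj_mul', sq]
  · rw [Matrix.nonneg_iff_posSemidef, Matrix.posSemidef_diagonal_iff]
    intro i
    exact_mod_cast norm_nonneg (f i)

theorem unitaryDefect_diagonal (f : ι → ℂ) :
    unitaryDefect (Matrix.diagonal f) = (∑ i, (‖f i‖ - 1) ^ 2) / Fintype.card ι := by
  rw [unitaryDefect, abs_diagonal, ← Matrix.diagonal_one, Matrix.diagonal_sub,
    Matrix.diagonal_pow, Matrix.trace_diagonal, Complex.re_sum]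
  congr 1
  refine Finset.sum_congr rfl fun i _ => ?_
  rw [Pi.pow_apply, ← Complex.ofReal_one, ← Complex.ofReal_sub, ← Complex.ofReal_pow,
    Complex.ofReal_re]

/-! ### Projection onto the diagonals of the Kraus space, and the bound for tensor powers. -/

variable [DecidableEq κ]

/-- The orthogonal projection onto the diagonals of the Kraus operator space. -/
def diagProj (d : κ → ι → ℂ) : Matrix ι ι ℂ :=
  diagColumns d * ((diagColumns d)ᴴ * diagColumns d)⁻¹ * (diagColumns d)ᴴ

omit [DecidableEq ι] in
theorem isHermitian_diagProj (d : κ → ι → ℂ) : (diagProj d).IsHermitian := by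
  rw [Matrix.IsHermitian, diagProj]
  simp [Matrix.conjTranspose_nonsing_inv, Matrix.mul_assoc]

omit [DecidableEq ι] in
theorem diagProj_mul_diagColumns (hG : IsUnit ((diagColumns d)ᴴ * diagColumns d).det) :
    diagProj d * diagColumns d = diagColumns d := by
  rw [diagProj, Matrix.mul_assoc, Matrix.mul_assoc, Matrix.nonsing_inv_mul _ hG, Matrix.mul_one]

omit [DecidableEq ι] in
theorem diagProj_mul_self (hG : IsUnit ((diagColumns d)ᴴ * diagColumns d).det) :
    diagProj d * diagProj d = diagProj d := by
  nth_rw 2 [diagProj]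
  rw [← Matrix.mul_assoc, ← Matrix.mul_assoc, diagProj_mul_diagColumns hG, ← diagProj]

omit [DecidableEq ι] in
theorem posSemidef_of_isHermitian_of_mul_self {p : Matrix ι ι ℂ} (hp : p.IsHermitian)
    (h : p * p = p) : p.PosSemidef := by
  rw [← h]
  nth_rw 1 [← hp.eq]
  exact Matrix.posSemidef_conjTranspose_mul_self p

omit [DecidableEq ι] in
theorem posSemidef_diagProj (hG : IsUnit ((diagColumns d)ᴴ * diagColumns d).det) :
    (diagProj d).PosSemidef :=
  posSemidef_of_isHermitian_of_mul_self (isHermitian_diagProj d) (diagProj_mul_self hG)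

theorem posSemidef_one_sub_diagProj (hG : IsUnit ((diagColumns d)ᴴ * diagColumns d).det) :
    (1 - diagProj d).PosSemidef :=
  posSemidef_of_isHermitian_of_mul_self (Matrix.isHermitian_one.sub (isHermitian_diagProj d))
    (by simp [sub_mul, mul_sub, diagProj_mul_self hG])

/-- A vector with entries in the unit disc is far from the diagonals of the Kraus operators. -/
theorem re_star_dotProduct_diagProj_le (hG : IsUnit ((diagColumns d)ᴴ * diagColumns d).det)
    {C : ℝ} (hC : ∀ L ∈ krausSpace (fun k => Matrix.diagonal (d k)), C ≤ unitaryDefect L)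
    {v : ι → ℂ} (hv : ∀ i, ‖v i‖ ≤ 1) :
    (star v ⬝ᵥ (diagProj d *ᵥ v)).re ≤ Fintype.card ι * (1 - C) := by
  have hmem : Matrix.diagonal (diagProj d *ᵥ v) ∈ krausSpace fun k => Matrix.diagonal (d k) := by
    rw [diagProj, Matrix.mul_assoc, ← Matrix.mulVec_mulVec]
    exact diagonal_mulVec_mem_krausSpace d _
  have hself : star v ⬝ᵥ (diagProj d *ᵥ v) = star (diagProj d *ᵥ v) ⬝ᵥ (diagProj d *ᵥ v) := by
    rw [Matrix.star_mulVec, (isHermitian_diagProj d).eq, ← Matrix.dotProduct_mulVec,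
      Matrix.mulVec_mulVec, diagProj_mul_self hG]
  have hdef := hC _ hmem
  rw [unitaryDefect_diagonal] at hdef
  generalize diagProj d *ᵥ v = L at hself hdef
  -- With `N` the cardinality of `ι` and `L = qv`: `‖L‖₂² = Re⟨v, L⟩ ≤ ‖L‖₁`, hence `N C ≤ ‖L‖₂² -
  -- 2‖L‖₁ + N ≤ N - ‖L‖₂²`.
  have h1 : (star v ⬝ᵥ L).re ≤ ∑ i, ‖L i‖ := by
    rw [dotProduct, Complex.re_sum]
    refine Finset.sum_le_sum fun i _ => (Complex.re_le_norm _).trans ?_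
    rw [norm_mul, Pi.star_apply, norm_star]
    exact mul_le_of_le_one_left (norm_nonneg _) (hv i)
  have h2 : (star v ⬝ᵥ L).re = ∑ i, ‖L i‖ ^ 2 := by
    rw [hself, dotProduct, Complex.re_sum]
    refine Finset.sum_congr rfl fun i _ => ?_
    rw [Pi.star_apply, Complex.star_def, Complex.conj_mul', ← Complex.ofReal_pow,
      Complex.ofReal_re]
  have h3 : ∑ i, (‖L i‖ - 1) ^ 2 = ∑ i, ‖L i‖ ^ 2 - 2 * ∑ i, ‖L i‖ + Fintype.card ι := by
    rw [Finset.mul_sum, ← Finset.sum_sub_distrib, Fintype.card_eq_sum_ones, Nat.cast_sum,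
      ← Finset.sum_add_distrib]
    refine Finset.sum_congr rfl fun i _ => ?_
    push_cast
    ring
  rcases isEmpty_or_nonempty ι with hι | hι
  · simp [dotProduct]
  · rw [le_div_iff₀ (by exact_mod_cast Fintype.card_pos)] at hdef
    linarith

/-- The test operator on `H^{⊗(m+1)}`: the projection `q` on the first factor. -/
def firstFactor (m : ℕ) (q : Matrix ι ι ℂ) : Matrix (Fin (m + 1) → ι) (Fin (m + 1) → ι) ℂ :=
  (q ⊗ₖ (1 : Matrix (Fin m → ι) (Fin m → ι) ℂ)).submatrix
    (Fin.consEquiv fun _ => ι).symm (Fin.consEquiv fun _ => ι).symm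

theorem posSemidef_firstFactor (m : ℕ) {q : Matrix ι ι ℂ} (hq : q.PosSemidef) :
    (firstFactor m q).PosSemidef :=
  (hq.kronecker Matrix.PosSemidef.one).submatrix _

omit [Fintype ι] in
theorem one_sub_firstFactor (m : ℕ) (q : Matrix ι ι ℂ) :
    1 - firstFactor m q = firstFactor m (1 - q) := by
  have h : (1 - q) ⊗ₖ (1 : Matrix (Fin m → ι) (Fin m → ι) ℂ) = 1 - q ⊗ₖ 1 := by
    ext p r
    rw [Matrix.sub_apply, ← Matrix.one_kronecker_one]
    simp only [Matrix.kroneckerMap_apply, Matrix.sub_apply, sub_mul]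
  rw [firstFactor, firstFactor, h, Matrix.submatrix_sub, Pi.sub_apply, Pi.sub_apply,
    Matrix.submatrix_one_equiv]

/-- The identity on the last `m` letters forces `k` and `l` to share their tail `r`. -/
theorem sum_firstFactor_mul (m : ℕ) (q : Matrix ι ι ℂ)
    (F : (Fin (m + 1) → ι) → (Fin (m + 1) → ι) → ℂ) :
    ∑ l, ∑ k, firstFactor m q l k * F k l
      = ∑ r : Fin m → ι, ∑ j, ∑ i, q j i * F (Fin.cons i r) (Fin.cons j r) := by
  rw [← (Fin.consEquiv fun _ => ι).sum_comp, Fintype.sum_prod_type, Finset.sum_comm]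
  refine Finset.sum_congr rfl fun r _ => Finset.sum_congr rfl fun j _ => ?_
  rw [← (Fin.consEquiv fun _ => ι).sum_comp, Fintype.sum_prod_type]
  refine Finset.sum_congr rfl fun i _ => ?_
  simp [firstFactor, Matrix.one_apply, Fin.consEquiv]

/-- Testing a single factor costs nothing for the channel, as `S` has unit diagonal on the untested
ones, and it keeps the estimate for unitaries inside `ℂ^ι`, whatever `m` is. -/
theorem le_distToUnitaryMixtures_tensorPower [Nonempty ι]
    (hd : ∀ i, (diagColumns d * (diagColumns d)ᴴ) i i = 1)
    (hG : IsUnit ((diagColumns d)ᴴ * diagColumns d).det) {C : ℝ}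
    (hC : ∀ L ∈ krausSpace (fun k => Matrix.diagonal (d k)), C ≤ unitaryDefect L) (m : ℕ) :
    ENNReal.ofReal C ≤ distToUnitaryMixtures
      (tensorPower (krausMap fun k => Matrix.diagonal (d k)) (m + 1)) := by
  set S := diagColumns d * (diagColumns d)ᴴ with hS
  have hSH : S.IsHermitian := Matrix.isHermitian_mul_conjTranspose_self _
  have hΦ := tensorPower_apply_of_schur (krausMap_diagonal_apply d) (m + 1)
  have hcard : (Fintype.card (Fin (m + 1) → ι) : ℝ)
      = Fintype.card (Fin m → ι) * Fintype.card ι := by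
    simp [pow_succ]
  have hpos : (0 : ℝ) < Fintype.card (Fin (m + 1) → ι) := by exact_mod_cast Fintype.card_pos
  have hval : choiFunctional (firstFactor m (diagProj d))
      (tensorPower (krausMap fun k => Matrix.diagonal (d k)) (m + 1))
      = Fintype.card (Fin (m + 1) → ι) := by
    have hqS : ∑ j, ∑ i, diagProj d j i * S i j = Fintype.card ι := by
      have : diagProj d * S = S := by rw [hS, ← Matrix.mul_assoc, diagProj_mul_diagColumns hG]
      simp_rw [← Matrix.mul_apply, this, hd]
      simp
    have : ∑ l, ∑ k, firstFactor m (diagProj d) l k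
        * tensorPower (krausMap fun k => Matrix.diagonal (d k)) (m + 1) (Matrix.single k l 1) k l
        = Fintype.card (Fin m → ι) * Fintype.card ι := by
      simp only [hΦ, Matrix.single_apply_same, mul_one]
      rw [sum_firstFactor_mul m _ fun k l => ∏ t, (diagColumns d * (diagColumns d)ᴴ) (k t) (l t)]
      simp only [Fin.prod_univ_succ, Fin.cons_zero, Fin.cons_succ, ← hS, hd,
        Finset.prod_const_one, mul_one, hqS]
      simp
    simp only [choiFunctional, LinearMap.coe_mk, AddHom.coe_mk, this, hcard]
    norm_cast
  have hU : ∀ U ∈ Matrix.unitaryGroup (Fin (m + 1) → ι) ℂ,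
      (∑ l, ∑ k, firstFactor m (diagProj d) l k * (U k k * star (U l l))).re
        ≤ Fintype.card (Fin (m + 1) → ι) * (1 - C) := by
    intro U hU
    -- Each tail `r` isolates the vector `i ↦ U_{(i,r),(i,r)}`, whose entries lie in the unit disc;
    -- the bound is applied slice by slice.
    rw [sum_firstFactor_mul m _ fun k l => U k k * star (U l l), Complex.re_sum, hcard, mul_assoc,
      ← nsmul_eq_mul, ← Finset.card_univ, ← Finset.sum_const]
    refine Finset.sum_le_sum fun r _ => ?_
    have := re_star_dotProduct_diagProj_le hG hC
      (v := fun i => U (Fin.cons i r) (Fin.cons i r)) fun i => entry_norm_bound_of_unitary hU _ _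
    refine le_trans (le_of_eq (congrArg Complex.re ?_)) this
    simp only [dotProduct, Matrix.mulVec, Pi.star_apply, Finset.mul_sum]
    exact Finset.sum_congr rfl fun j _ => Finset.sum_congr rfl fun i _ => by ring
  have hherm : ∀ X, tensorPower (krausMap fun k => Matrix.diagonal (d k)) (m + 1) Xᴴ
      = (tensorPower (krausMap fun k => Matrix.diagonal (d k)) (m + 1) X)ᴴ := by
    intro X
    ext k l
    simp only [Matrix.conjTranspose_apply, hΦ, star_mul', star_prod, ← hS, hSH.apply]
  have key := le_distToUnitaryMixtures hherm (posSemidef_firstFactor m (posSemidef_diagProj hG))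
    (by rw [one_sub_firstFactor]
        exact posSemidef_firstFactor m (posSemidef_one_sub_diagProj hG)) hU
  rw [hval] at key
  convert key using 2
  field_simp
  ring

end Schur

/-! ### Factorizable maps -/

section Markov

variable {ι : Type*} [Fintype ι] [DecidableEq ι] {P : Type u} [CStarAlgebra P]
  {χ : P →ₗ[ℂ] ℂ} {J₀ J₁ : Matrix ι ι ℂ →⋆ₐ[ℂ] P}

theorem IsMarkovEmbedding.map_conj_mul (h₀ : IsMarkovEmbedding χ J₀) (x : P)
    (A B : Matrix ι ι ℂ) : χ (J₀ A * x * J₀ B) = χ (x * J₀ (B * A)) := by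
  rw [mul_assoc, h₀.2, mul_assoc, ← map_mul]

/-- `χ(x* x)` for `x = ∑ J₁(A r) J₀(B r)`, when `J₀* ∘ J₁` has Kraus operators `E`. -/
theorem map_star_mul_self_of_kraus {κ ρ : Type*} [Fintype κ] [Fintype ρ]
    {E : κ → Matrix ι ι ℂ} (h₀ : IsMarkovEmbedding χ J₀)
    (hE : ∀ A B, (krausMap E A * B).trace / Fintype.card ι = χ (J₁ A * J₀ B))
    (A B : ρ → Matrix ι ι ℂ) :
    χ (star (∑ r, J₁ (A r) * J₀ (B r)) * ∑ r, J₁ (A r) * J₀ (B r))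
      = (∑ k, ((∑ r, A r * (E k)ᴴ * B r)ᴴ * ∑ r, A r * (E k)ᴴ * B r).trace) / Fintype.card ι := by
  have hterm : ∀ r s, χ (star (J₁ (A r) * J₀ (B r)) * (J₁ (A s) * J₀ (B s)))
      = (∑ k, ((A r * (E k)ᴴ * B r)ᴴ * (A s * (E k)ᴴ * B s)).trace) / Fintype.card ι := by
    intro r s
    -- The two `J₁` factors become adjacent and merge; the outer `J₀` factors merge under `χ`
    -- because `J₀` maps into its centralizer.
    have : star (J₁ (A r) * J₀ (B r)) * (J₁ (A s) * J₀ (B s))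
        = J₀ (B r)ᴴ * J₁ ((A r)ᴴ * A s) * J₀ (B s) := by
      simp only [star_mul, ← map_star, Matrix.star_eq_conjTranspose, map_mul, mul_assoc]
    rw [this, h₀.map_conj_mul, ← hE]
    congr 1
    simp only [krausMap, LinearMap.coe_mk, AddHom.coe_mk, Finset.sum_mul, Matrix.trace_sum]
    refine Finset.sum_congr rfl fun k _ => ?_
    simp only [Matrix.conjTranspose_mul, Matrix.conjTranspose_conjTranspose]
    rw [← Matrix.mul_assoc _ (B s) (B r)ᴴ, Matrix.trace_mul_comm _ (B r)ᴴ]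
    simp only [Matrix.mul_assoc]
  rw [star_sum, Finset.sum_mul_sum]
  simp only [map_sum, hterm, Matrix.conjTranspose_sum, Finset.sum_mul_sum, Matrix.trace_sum,
    ← Finset.sum_div]
  congr 1
  rw [Finset.sum_comm (γ := κ)]
  refine Finset.sum_congr rfl fun r _ => ?_
  rw [Finset.sum_comm]

/-- The intertwiner `∑ₘ J₁(|m⟩⟨i|) J₀(|i⟩⟨m|)` of `J₀` and `J₁`. -/
def intertwiner (J₀ J₁ : Matrix ι ι ℂ →⋆ₐ[ℂ] P) (i : ι) : P :=
  ∑ m, J₁ (Matrix.single m i 1) * J₀ (Matrix.single i m 1)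

/-- Both sides expand to `∑ A p m • J₁(|p⟩⟨i|) J₀(|i⟩⟨m|)` over `p` and `m`. -/
theorem map_mul_intertwiner (i : ι) (A : Matrix ι ι ℂ) :
    J₁ A * intertwiner J₀ J₁ i = intertwiner J₀ J₁ i * J₀ A := by
  have h₁ : ∀ m, A * Matrix.single m i (1 : ℂ) = ∑ p, A p m • Matrix.single p i 1 := by
    intro m
    ext a b
    by_cases hb : b = i
    · subst hb; simp [Matrix.sum_apply, Matrix.single_apply]
    · simp [Matrix.sum_apply, hb, Ne.symm hb]
  have h₀ : ∀ m, Matrix.single i m (1 : ℂ) * A = ∑ p, A m p • Matrix.single i p 1 := by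
    intro m
    ext a b
    by_cases ha : a = i
    · subst ha; simp [Matrix.sum_apply, Matrix.single_apply]
    · simp [Matrix.sum_apply, ha, Ne.symm ha]
  simp only [intertwiner, Finset.mul_sum, Finset.sum_mul, mul_assoc, ← map_mul, h₀]
  simp only [← mul_assoc, ← map_mul, h₁, map_sum, map_smul, Finset.sum_mul, Finset.mul_sum,
    smul_mul_assoc, mul_smul_comm]
  rw [Finset.sum_comm]

/-- The right factor turns `J₀ A` into `J₁ A`, and the starred one turns it back. -/
theorem commute_star_intertwiner_mul_intertwiner (i j : ι) (A : Matrix ι ι ℂ) :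
    Commute (star (intertwiner J₀ J₁ i) * intertwiner J₀ J₁ j) (J₀ A) := by
  have h := congrArg star (map_mul_intertwiner (J₀ := J₀) (J₁ := J₁) i Aᴴ)
  simp only [star_mul, ← map_star, Matrix.star_eq_conjTranspose,
    Matrix.conjTranspose_conjTranspose] at h
  rw [Commute, SemiconjBy, mul_assoc, ← map_mul_intertwiner, ← mul_assoc, h, mul_assoc]

theorem map_intertwiner_mul_comm (h₀ : IsMarkovEmbedding χ J₀) (h₁ : IsMarkovEmbedding χ J₁)
    (i : ι) (x : P) : χ (intertwiner J₀ J₁ i * x) = χ (x * intertwiner J₀ J₁ i) := by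
  simp only [intertwiner, Finset.sum_mul, Finset.mul_sum, map_sum]
  refine Finset.sum_congr rfl fun m _ => ?_
  rw [mul_assoc, h₁.2, mul_assoc, h₀.2, mul_assoc]

/-- For an isometry `v`, `1 - v v*` is a projection. Since `χ` is tracial on `v`, its value there is
`χ 1 - χ(v* v) = 0`, and faithfulness kills it. -/
theorem intertwiner_mul_star_eq_one (h₀ : IsMarkovEmbedding χ J₀) (h₁ : IsMarkovEmbedding χ J₁)
    (hfaith : ∀ x, χ (star x * x) = 0 → x = 0) {i : ι}
    (hi : star (intertwiner J₀ J₁ i) * intertwiner J₀ J₁ i = 1) :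
    intertwiner J₀ J₁ i * star (intertwiner J₀ J₁ i) = 1 := by
  have hχ : χ (intertwiner J₀ J₁ i * star (intertwiner J₀ J₁ i)) = χ 1 := by
    rw [map_intertwiner_mul_comm h₀ h₁, hi]
  generalize intertwiner J₀ J₁ i = v at hi hχ
  have hproj : star (1 - v * star v) * (1 - v * star v) = 1 - v * star v := by
    have : v * star v * (v * star v) = v * star v := by
      rw [mul_assoc, ← mul_assoc (star v), hi, one_mul]
    simp only [star_sub, star_one, star_mul, star_star, sub_mul, mul_sub, one_mul, mul_one, this]
    simp
  have := hfaith (1 - v * star v) (by rw [hproj, map_sub, hχ, sub_self])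
  exact (sub_eq_zero.mp this).symm

/-- `M_d` and its commutant are independent: an element of the commutant killed by one matrix unit
vanishes. -/
theorem eq_zero_of_mul_map_single_eq_zero {c : P} (hc : ∀ A, Commute c (J₀ A)) {k : ι}
    (hk : c * J₀ (Matrix.single k k 1) = 0) : c = 0 := by
  have h : ∀ m, c * J₀ (Matrix.single m m 1) = 0 := by
    intro m
    have : (Matrix.single m m 1 : Matrix ι ι ℂ)
        = Matrix.single m k 1 * Matrix.single k k 1 * Matrix.single k m 1 := by simp
    rw [this, map_mul, map_mul, ← mul_assoc, ← mul_assoc, (hc _).eq, mul_assoc (J₀ _), hk]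
    simp
  rw [← mul_one c, ← map_one J₀, ← Matrix.sum_single_one, map_sum, Finset.mul_sum]
  exact Finset.sum_eq_zero fun m _ => h m

theorem sum_single_mul_mul_single (i : ι) (X : Matrix ι ι ℂ) :
    ∑ m, Matrix.single m i 1 * X * Matrix.single i m 1 = X i i • (1 : Matrix ι ι ℂ) := by
  simp [← Matrix.sum_single_one, Finset.smul_sum]

/-- If the Kraus operators are dual to diagonal matrix units, then `1` is a combination of
intertwiners. -/
theorem sum_intertwiner_mul_eq_one {κ : Type*} [Fintype κ] [DecidableEq κ]
    {E : κ → Matrix ι ι ℂ} (h₀ : IsMarkovEmbedding χ J₀)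
    (hfaith : ∀ x, χ (star x * x) = 0 → x = 0)
    (hfact : ∀ A B, (krausMap E A * B).trace / Fintype.card ι = χ (J₁ A * J₀ B))
    {s : κ → ι} (hs : ∀ k l, (E k)ᴴ (s l) (s l) = if k = l then 1 else 0) :
    ∑ l, intertwiner J₀ J₁ (s l) * J₀ (E l)ᴴ = 1 := by
  -- The extra `Unit` index supplies the term `-1`, so that `∑ J₁(A r) J₀(B r)` is the difference to
  -- be shown zero.
  let A : κ × ι ⊕ Unit → Matrix ι ι ℂ :=
    Sum.elim (fun p => Matrix.single p.2 (s p.1) 1) fun _ => -1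
  let B : κ × ι ⊕ Unit → Matrix ι ι ℂ :=
    Sum.elim (fun p => Matrix.single (s p.1) p.2 1 * (E p.1)ᴴ) fun _ => 1
  have hx : ∑ r, J₁ (A r) * J₀ (B r) = ∑ l, intertwiner J₀ J₁ (s l) * J₀ (E l)ᴴ - 1 := by
    simp [A, B, Fintype.sum_prod_type, intertwiner, Finset.sum_mul, mul_assoc, sub_eq_add_neg]
  -- Summing over `m` extracts the entry of `E_k†` at `s l`; by duality only `l = k` survives,
  -- leaving `E_k† - E_k† = 0`.
  have hzero : ∀ k, ∑ r, A r * (E k)ᴴ * B r = 0 := by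
    intro k
    have : ∀ l, ∑ m, Matrix.single m (s l) 1 * (E k)ᴴ * (Matrix.single (s l) m 1 * (E l)ᴴ)
        = if k = l then (E l)ᴴ else 0 := by
      intro l
      simp only [← Matrix.mul_assoc _ _ (E l)ᴴ]
      rw [← Finset.sum_mul, sum_single_mul_mul_single, hs]
      split_ifs <;> simp
    simp only [A, B, Fintype.sum_sum_type, Sum.elim_inl, Sum.elim_inr, Fintype.sum_prod_type, this]
    simp
  rw [← sub_eq_zero, ← hx]
  refine hfaith _ ?_
  rw [map_star_mul_self_of_kraus h₀ hfact]
  simp [hzero]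

/-- Multiply `x* x = 1`, for `x` the sum in `hw`, by `J₀(|m⟩⟨m|)`. The diagonal matrices then act as
their `m`-th entries, and the matrix unit can be dropped because the remaining element commutes with
the range of `J₀`. -/
theorem sum_smul_star_mul_eq_one {κ : Type*} [Fintype κ] {d : κ → ι → ℂ} {w : κ → P}
    (hw : ∑ l, w l * J₀ (Matrix.diagonal (d l))ᴴ = 1)
    (hcomm : ∀ i j A, Commute (star (w i) * w j) (J₀ A)) (m : ι) :
    ∑ i, ∑ j, (d i m * star (d j m)) • (star (w i) * w j) = 1 := by
  have hterm : ∀ i j, star (w i * J₀ (Matrix.diagonal (d i))ᴴ) * (w j * J₀ (Matrix.diagonal (d j))ᴴ)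
      * J₀ (Matrix.single m m 1)
      = (d i m * star (d j m)) • (star (w i) * w j) * J₀ (Matrix.single m m 1) := by
    intro i j
    rw [star_mul, ← map_star, Matrix.star_eq_conjTranspose, Matrix.conjTranspose_conjTranspose,
      mul_assoc (J₀ _), ← mul_assoc (star (w i)), ← mul_assoc (J₀ _), ← (hcomm i j _).eq,
      mul_assoc, mul_assoc, ← map_mul, ← map_mul, smul_mul_assoc, ← mul_smul_comm, ← map_smul]
    congr 2
    ext a b
    simp only [Matrix.diagonal_conjTranspose, Matrix.diagonal_mul, Matrix.smul_apply,
      Matrix.single_apply, smul_eq_mul, Pi.star_apply]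
    split_ifs with h
    · rw [h.1, mul_assoc]
    · simp
  have hsq := congrArg (fun x => star x * x * J₀ (Matrix.single m m 1)) hw
  simp only [star_sum, Finset.sum_mul_sum, star_one, one_mul] at hsq
  simp only [Finset.sum_mul, hterm] at hsq
  simp only [← Finset.sum_mul] at hsq
  rw [← sub_eq_zero]
  refine eq_zero_of_mul_map_single_eq_zero (J₀ := J₀) (k := m) (fun A => ?_) ?_
  · exact (Commute.sum_left _ _ _ fun i _ => Commute.sum_left _ _ _ fun j _ =>
      (hcomm i j A).smul_left _).sub_left (Commute.one_left _)
  · rw [sub_mul, one_mul, hsq, sub_self]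

end Markov

/-! ### The example -/

/-- The diagonals of the Kraus operators of the example. -/
def exampleDiag : Fin 2 → Fin 4 → ℂ :=
  ![![1, 0, 1 / (Real.sqrt 2 : ℂ), 1 / (Real.sqrt 2 : ℂ)],
    ![0, 1, 1 / (Real.sqrt 2 : ℂ), -Complex.I / (Real.sqrt 2 : ℂ)]]

theorem exampleKraus_eq : exampleKraus = fun k => Matrix.diagonal (exampleDiag k) := by
  funext k
  fin_cases k <;> rfl

theorem exampleChannel_eq :
    exampleChannel = krausMap fun k => Matrix.diagonal (exampleDiag k) := by
  rw [exampleChannel, exampleKraus_eq]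

theorem inv_sqrt_two_mul_self : (Real.sqrt 2 : ℂ)⁻¹ * (Real.sqrt 2 : ℂ)⁻¹ = 1 / 2 := by
  rw [← mul_inv, ← Complex.ofReal_mul, Real.mul_self_sqrt zero_le_two]
  norm_num

theorem exampleDiag_schur_diag (i : Fin 4) :
    (diagColumns exampleDiag * (diagColumns exampleDiag)ᴴ) i i = 1 := by
  have h := inv_sqrt_two_mul_self
  have hI := Complex.I_mul_I
  fin_cases i <;>
    simp [Matrix.mul_apply, Fin.sum_univ_two, diagColumns, exampleDiag]
  · linear_combination 2 * h
  · linear_combination (1 - Complex.I * Complex.I) * h - 1 / 2 * hI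

theorem isUnit_det_exampleDiag_gram :
    IsUnit ((diagColumns exampleDiag)ᴴ * diagColumns exampleDiag).det := by
  have h := inv_sqrt_two_mul_self
  have hI := Complex.I_mul_I
  have h00 : ((diagColumns exampleDiag)ᴴ * diagColumns exampleDiag) 0 0 = 2 := by
    simp [Matrix.mul_apply, Fin.sum_univ_four, diagColumns, exampleDiag]
    linear_combination 2 * h
  have h11 : ((diagColumns exampleDiag)ᴴ * diagColumns exampleDiag) 1 1 = 2 := by
    simp [Matrix.mul_apply, Fin.sum_univ_four, diagColumns, exampleDiag]
    linear_combination (1 - Complex.I * Complex.I) * h - 1 / 2 * hI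
  have h01 : ((diagColumns exampleDiag)ᴴ * diagColumns exampleDiag) 0 1
      = (1 - Complex.I) / 2 := by
    simp [Matrix.mul_apply, Fin.sum_univ_four, diagColumns, exampleDiag]
    linear_combination (1 - Complex.I) * h
  have h10 : ((diagColumns exampleDiag)ᴴ * diagColumns exampleDiag) 1 0
      = (1 + Complex.I) / 2 := by
    simp [Matrix.mul_apply, Fin.sum_univ_four, diagColumns, exampleDiag]
    linear_combination (1 + Complex.I) * h
  have hdet : ((diagColumns exampleDiag)ᴴ * diagColumns exampleDiag).det = 7 / 2 := by
    rw [Matrix.det_fin_two, h00, h11, h01, h10]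
    linear_combination 1 / 4 * hI
  rw [hdet]
  norm_num

/-! ### The unitary defect on the Kraus space of the example. -/

theorem exampleDiag_mulVec (c : Fin 2 → ℂ) : diagColumns exampleDiag *ᵥ c
    = ![c 0, c 1, (c 0 + c 1) / (Real.sqrt 2 : ℂ), (c 0 - Complex.I * c 1) / (Real.sqrt 2 : ℂ)] := by
  funext i
  fin_cases i <;>
    simp [Matrix.mulVec, dotProduct, Fin.sum_univ_two, diagColumns, exampleDiag] <;> ring

theorem unitaryDefect_exampleDiag (c : Fin 2 → ℂ) :
    unitaryDefect (Matrix.diagonal (diagColumns exampleDiag *ᵥ c))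
      = ((‖c 0‖ - 1) ^ 2 + (‖c 1‖ - 1) ^ 2 + (‖c 0 + c 1‖ / Real.sqrt 2 - 1) ^ 2
        + (‖c 0 - Complex.I * c 1‖ / Real.sqrt 2 - 1) ^ 2) / 4 := by
  rw [unitaryDefect_diagonal, exampleDiag_mulVec, Fin.sum_univ_four]
  simp [abs_of_nonneg (Real.sqrt_nonneg 2)]

/-- Zero defect would need `|c 0| = |c 1| = 1` and `|c 0 + c 1|² = |c 0 - i c 1|² = 2`. The last two
make the real and imaginary parts of `conj (c 0) * c 1` vanish, although its modulus is `1`. -/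
theorem unitaryDefect_exampleDiag_pos (c : Fin 2 → ℂ) :
    0 < unitaryDefect (Matrix.diagonal (diagColumns exampleDiag *ᵥ c)) := by
  rw [unitaryDefect_exampleDiag]
  by_contra hle
  have hs : (0 : ℝ) < Real.sqrt 2 := by positivity
  have hzero : ∀ x y z w : ℝ, ¬ 0 < (x ^ 2 + y ^ 2 + z ^ 2 + w ^ 2) / 4 →
      x = 0 ∧ y = 0 ∧ z = 0 ∧ w = 0 := by
    intro x y z w h
    refine ⟨?_, ?_, ?_, ?_⟩ <;>
      exact pow_eq_zero_iff two_ne_zero |>.mp <| le_antisymm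
        (by linarith [sq_nonneg x, sq_nonneg y, sq_nonneg z, sq_nonneg w]) (sq_nonneg _)
  obtain ⟨h0, h1, h2, h3⟩ := hzero _ _ _ _ hle
  have hsq : ∀ z : ℂ, ‖z‖ / Real.sqrt 2 - 1 = 0 → z.re * z.re + z.im * z.im = 2 := by
    intro z hz
    rw [sub_eq_zero, div_eq_one_iff_eq hs.ne'] at hz
    rw [← Complex.normSq_apply, ← Complex.sq_norm, hz, Real.sq_sqrt zero_le_two]
  have hsq1 : ∀ z : ℂ, ‖z‖ - 1 = 0 → z.re * z.re + z.im * z.im = 1 := by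
    intro z hz
    rw [← Complex.normSq_apply, ← Complex.sq_norm, sub_eq_zero.mp hz, one_pow]
  replace h0 := hsq1 _ h0
  replace h1 := hsq1 _ h1
  replace h2 := hsq _ h2
  replace h3 := hsq _ h3
  simp only [Complex.add_re, Complex.add_im, Complex.sub_re, Complex.sub_im, Complex.mul_re,
    Complex.mul_im, Complex.I_re, Complex.I_im] at h2 h3
  have hre : (c 0).re * (c 1).re + (c 0).im * (c 1).im = 0 := by linarith
  have him : (c 0).re * (c 1).im - (c 0).im * (c 1).re = 0 := by linarith
  have : ((c 0).re * (c 0).re + (c 0).im * (c 0).im) * ((c 1).re * (c 1).re + (c 1).im * (c 1).im)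
      = 0 := by
    linear_combination ((c 0).re * (c 1).re + (c 0).im * (c 1).im) * hre
      + ((c 0).re * (c 1).im - (c 0).im * (c 1).re) * him
  rw [h0, h1] at this
  norm_num at this

theorem exists_isMinOn_unitaryDefect_exampleDiag : ∃ c₀ : Fin 2 → ℂ, ∀ c : Fin 2 → ℂ,
    unitaryDefect (Matrix.diagonal (diagColumns exampleDiag *ᵥ c₀))
      ≤ unitaryDefect (Matrix.diagonal (diagColumns exampleDiag *ᵥ c)) := by
  have hcont : Continuous fun c : Fin 2 → ℂ =>
      unitaryDefect (Matrix.diagonal (diagColumns exampleDiag *ᵥ c)) := by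
    simp only [unitaryDefect_exampleDiag]
    fun_prop
  -- Radius `3` suffices: outside the ball some `|c i| > 3`, so the defect is at least `(3 - 1)² / 4
  -- = 1`, its value at `c = 0`.
  obtain ⟨c₀, -, hmin⟩ := (isCompact_closedBall (0 : Fin 2 → ℂ) 3).exists_isMinOn
    ⟨0, by simp⟩ hcont.continuousOn
  refine ⟨c₀, fun c => ?_⟩
  by_cases hc : c ∈ Metric.closedBall (0 : Fin 2 → ℂ) 3
  · exact hmin hc
  · refine (hmin (Metric.mem_closedBall_self (by norm_num))).trans ?_
    rw [mem_closedBall_zero_iff, pi_norm_le_iff_of_nonneg (by norm_num)] at hc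
    push Not at hc
    obtain ⟨i, hi⟩ := hc
    simp only [unitaryDefect_exampleDiag, Pi.zero_apply, norm_zero, mul_zero, add_zero, sub_zero,
      zero_div, zero_sub]
    have hbig : 4 ≤ (‖c i‖ - 1) ^ 2 := by nlinarith
    have h0 := sq_nonneg (‖c 0‖ - 1)
    have h1 := sq_nonneg (‖c 1‖ - 1)
    have h2 := sq_nonneg (‖c 0 + c 1‖ / Real.sqrt 2 - 1)
    have h3 := sq_nonneg (‖c 0 - Complex.I * c 1‖ / Real.sqrt 2 - 1)
    fin_cases i <;> simp only [Fin.zero_eta, Fin.mk_one, Fin.isValue] at hbig <;> linarith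

/-! ### Unitaries, distances, linear independence and factorizability for the example. -/

theorem exampleKraus_not_unitary {L : Matrix (Fin 4) (Fin 4) ℂ}
    (hL : L ∈ krausSpace exampleKraus) : L ∉ Matrix.unitaryGroup (Fin 4) ℂ := by
  rw [exampleKraus_eq, mem_krausSpace_diagonal_iff] at hL
  obtain ⟨c, rfl⟩ := hL
  intro hU
  have := unitaryDefect_exampleDiag_pos c
  rw [unitaryDefect, CFC.abs_of_mem_unitary hU] at this
  simp at this

theorem exists_isLeast_unitaryDefect : ∃ C : ℝ,
    IsLeast (unitaryDefect '' (krausSpace exampleKraus : Set (Matrix (Fin 4) (Fin 4) ℂ))) C ∧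
    0 < C ∧ ∀ n : ℕ, 1 ≤ n →
      ENNReal.ofReal C ≤ distToUnitaryMixtures (tensorPower exampleChannel n) := by
  obtain ⟨c₀, hmin⟩ := exists_isMinOn_unitaryDefect_exampleDiag
  have hC : ∀ L ∈ krausSpace (fun k => Matrix.diagonal (exampleDiag k)),
      unitaryDefect (Matrix.diagonal (diagColumns exampleDiag *ᵥ c₀)) ≤ unitaryDefect L := by
    intro L hL
    obtain ⟨c, rfl⟩ := (mem_krausSpace_diagonal_iff _ _).mp hL
    exact hmin c
  refine ⟨_, ⟨⟨_, ?_, rfl⟩, ?_⟩, unitaryDefect_exampleDiag_pos c₀, fun n hn => ?_⟩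
  · rw [exampleKraus_eq]
    exact diagonal_mulVec_mem_krausSpace exampleDiag c₀
  · rintro _ ⟨L, hL, rfl⟩
    rw [exampleKraus_eq] at hL
    exact hC L hL
  · obtain ⟨m, rfl⟩ := Nat.exists_eq_add_of_le' hn
    rw [exampleChannel_eq]
    exact le_distToUnitaryMixtures_tensorPower exampleDiag_schur_diag isUnit_det_exampleDiag_gram
      hC m

theorem not_asymptoticBirkhoff_exampleChannel : ¬ AsymptoticBirkhoff exampleChannel := by
  obtain ⟨C, -, hpos, hC⟩ := exists_isLeast_unitaryDefect
  intro h
  have hle : ENNReal.ofReal C ≤ 0 :=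
    ge_of_tendsto h (Filter.eventually_atTop.mpr ⟨1, hC⟩)
  exact (ENNReal.ofReal_pos.mpr hpos).not_ge hle

/-- All four products are diagonal. Entries `0` and `1` isolate the coefficients `g (0, 0)` and `g
(1, 1)`; entries `2` and `3` then give the sum and difference of the two mixed coefficients. -/
theorem linearIndependent_exampleKraus : LinearIndependent ℂ (fun p : Fin 2 × Fin 2 =>
    (exampleKraus p.1).conjTranspose * exampleKraus p.2) := by
  have h := inv_sqrt_two_mul_self
  have hI := Complex.I_mul_I
  rw [Fintype.linearIndependent_iff]
  intro g hg
  rw [Fintype.sum_prod_type] at hg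
  have hk := fun k : Fin 4 => congrFun (congrFun hg k) k
  simp only [exampleKraus_eq, Matrix.diagonal_conjTranspose, Matrix.diagonal_mul_diagonal,
    Fin.sum_univ_two, Matrix.add_apply, Matrix.smul_apply, Matrix.diagonal_apply_eq,
    Matrix.zero_apply, Pi.star_apply, smul_eq_mul] at hk
  have h0 := hk 0
  have h1 := hk 1
  have h2 := hk 2
  have h3 := hk 3
  simp [exampleDiag] at h0 h1 h2 h3
  rw [h0, h1, h] at h2
  rw [h0, h1] at h3
  have h01 : g (0, 1) = 0 := by
    linear_combination h2 + Complex.I * h3 + (Complex.I * Complex.I) * (g (0, 1) - g (1, 0)) * h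
      + 1 / 2 * (g (0, 1) - g (1, 0)) * hI
  have h10 : g (1, 0) = 0 := by linear_combination 2 * h2 - h01
  rintro ⟨a, b⟩
  fin_cases a <;> fin_cases b <;> assumption

theorem not_isFactorizable_exampleChannel : ¬ IsFactorizable.{u} exampleChannel := by
  rintro ⟨P, _, _, _, _, χ, J₀, J₁, hχ, h₀, h₁, hfact⟩
  rw [exampleChannel_eq] at hfact
  -- On the first two basis vectors the diagonals of `E₁`, `E₂` are `(1, 0)` and `(0, 1)`, which is
  -- the required duality.
  have hone := sum_intertwiner_mul_eq_one h₀ hχ.faithful hfact (s := ![0, 1]) (by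
    intro k l
    fin_cases k <;> fin_cases l <;> simp [exampleDiag])
  have hsum := sum_smul_star_mul_eq_one hone
    fun i j A => commute_star_intertwiner_mul_intertwiner _ _ A
  have hunit := intertwiner_mul_star_eq_one h₀ h₁ hχ.faithful (i := 0)
  have h := inv_sqrt_two_mul_self
  have h0 := hsum 0
  have h1 := hsum 1
  have h2 := hsum 2
  have h3 := hsum 3
  simp only [Fin.sum_univ_two, Matrix.cons_val_zero, Matrix.cons_val_one] at h0 h1 h2 h3
  generalize intertwiner J₀ J₁ 0 = v at *
  generalize intertwiner J₀ J₁ 1 = w at *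
  have hentries : exampleDiag 0 2 * star (exampleDiag 0 2) = 1 / 2 ∧
      exampleDiag 0 2 * star (exampleDiag 1 2) = 1 / 2 ∧
      exampleDiag 1 2 * star (exampleDiag 0 2) = 1 / 2 ∧
      exampleDiag 1 2 * star (exampleDiag 1 2) = 1 / 2 ∧
      exampleDiag 0 3 * star (exampleDiag 0 3) = 1 / 2 ∧
      exampleDiag 0 3 * star (exampleDiag 1 3) = Complex.I / 2 ∧
      exampleDiag 1 3 * star (exampleDiag 0 3) = -Complex.I / 2 ∧
      exampleDiag 1 3 * star (exampleDiag 1 3) = 1 / 2 := by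
    have hI := Complex.I_mul_I
    refine ⟨?_, ?_, ?_, ?_, ?_, ?_, ?_, ?_⟩ <;> simp [exampleDiag, div_eq_mul_inv]
    · linear_combination h
    · linear_combination h
    · linear_combination h
    · linear_combination h
    · linear_combination h
    · linear_combination Complex.I * h
    · linear_combination Complex.I * h
    · linear_combination (-Complex.I * Complex.I) * h - 1 / 2 * hI
  obtain ⟨e1, e2, e3, e4, e5, e6, e7, e8⟩ := hentries
  rw [e1, e2, e3, e4] at h2
  rw [e5, e6, e7, e8] at h3
  simp [exampleDiag] at h0 h1
  rw [h0, h1] at h2 h3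
  -- Given `v* v = w* w = 1`, `h2` says `v* w + w* v = 0` and `h3` says `v* w - w* v = 0`.
  have hvw : star v * w = 0 := by
    linear_combination (norm := skip) h2 - Complex.I • h3
    match_scalars <;> ring_nf <;> simp
  have hw0 : w = 0 := by rw [← one_mul w, ← hunit h0, mul_assoc, hvw, mul_zero]
  have : χ 1 = 0 := by rw [← h1, hw0, mul_zero, map_zero]
  rw [hχ.map_one] at this
  exact one_ne_zero this

end

end QBirkhoff

theorem mainTheorem9 :
    QBirkhoff.IsUnitalQuantumChannel QBirkhoff.exampleChannel ∧
    QBirkhoff.IsSchurChannel QBirkhoff.exampleChannel ∧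
    (∀ L ∈ QBirkhoff.krausSpace QBirkhoff.exampleKraus, L ∉ Matrix.unitaryGroup (Fin 4) ℂ) ∧
    (∃ C : ℝ,
      IsLeast (QBirkhoff.unitaryDefect '' (QBirkhoff.krausSpace QBirkhoff.exampleKraus :
        Set (Matrix (Fin 4) (Fin 4) ℂ))) C ∧
      0 < C ∧
      ∀ n : ℕ, 1 ≤ n → ENNReal.ofReal C ≤ QBirkhoff.distToUnitaryMixtures
        (QBirkhoff.tensorPower QBirkhoff.exampleChannel n)) ∧
    ¬ QBirkhoff.AsymptoticBirkhoff QBirkhoff.exampleChannel ∧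
    LinearIndependent ℂ (fun p : Fin 2 × Fin 2 =>
      (QBirkhoff.exampleKraus p.1).conjTranspose * QBirkhoff.exampleKraus p.2) ∧
    ¬ QBirkhoff.IsFactorizable.{u} QBirkhoff.exampleChannel :=
  ⟨QBirkhoff.exampleChannel_eq ▸ QBirkhoff.isUnitalQuantumChannel_krausMap_diagonal
      QBirkhoff.exampleDiag_schur_diag,
    QBirkhoff.exampleChannel_eq ▸ QBirkhoff.isSchurChannel_krausMap_diagonal
      QBirkhoff.exampleDiag_schur_diag,
    fun _ => QBirkhoff.exampleKraus_not_unitary,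
    QBirkhoff.exists_isLeast_unitaryDefect,
    QBirkhoff.not_asymptoticBirkhoff_exampleChannel,
    QBirkhoff.linearIndependent_exampleKraus,
    QBirkhoff.not_isFactorizable_exampleChannel⟩
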